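/- Let $F$ be a field and let ${\rm Zar}(F)$ be the set of valuation rings of $F$, i.e. the subrings $V\subseteq F$ such that $t\in V$ or $t^{-1}\in V$ for every $0\neq t\in F$ (so $F\in{\rm Zar}(F)$). Write ${\mathfrak M}_V$ for the maximal ideal of $V$. For $X\subseteq{\rm Zar}(F)$ put $A(X)=\bigcap_{V\in X}V$ and $J(X)=\bigcap_{V\in X}{\mathfrak M}_V$, with $A(\emptyset)=F$. Let $\lim X$ be the set of limit points of $X$ in the patch topology of ${\rm Zar}(F)$, i.e. the topology generated by the sets $\{V : x\in V\}$ and $\{V : x\notin V\}$, $x\in F$. A Prüfer domain is an integral domain each of whose localizations at a maximal ideal is a valuation domain; a $G$-domain is an integral domain in which the intersection of all nonzero prime ideals is nonzero (for a field this intersection is the whole ring, so fields are $G$-domains). A valuation ring has rank one if its Krull dimension is $1$. Let $X$ be a nonempty set of rank one valuation rings in ${\rm Zar}(F)$. Then $A(X)$ is a Prüfer $G$-domain with quotient field $F$ if and only if $J(X)\neq 0$ and $A(\lim X)$ is a Prüfer $G$-domain with quotient field $F$. -/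

import Mathlib

/-- The patch (constructible) topology on the space `Zar(F)` of valuation rings of `F`
(`F` itself included). The sets `U(x) = {V | x ∈ V}` and their complements form a subbasis: their
finite intersections are the sets `U(x₁, …, xₙ) ∩ V(y₁) ∩ ⋯ ∩ V(yₘ)`. -/
@[reducible] def patchTopology (F : Type*) [Field F] : TopologicalSpace (ValuationSubring F) :=
  TopologicalSpace.generateFrom
    ({s | ∃ x : F, s = {V | x ∈ V}} ∪ {s | ∃ x : F, s = {V | x ∉ V}})

/-- `lim(X)`, the set of limit (accumulation) points of `X` in the patch topology. -/
def patchLim {F : Type*} [Field F] (X : Set (ValuationSubring F)) : Set (ValuationSubring F) :=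
  @derivedSet (ValuationSubring F) (patchTopology F) X

/-- `A(X) = ⋂_{V ∈ X} V`, as a subring of `F`. The empty intersection is `F`. -/
def ringA {F : Type*} [Field F] (X : Set (ValuationSubring F)) : Subring F :=
  ⨅ V ∈ X, V.toSubring

/-- `J(X) = ⋂_{V ∈ X} 𝔐_V`, the maximal ideal `𝔐_V` of `V` being viewed as a subset of `F`. -/
def radJ {F : Type*} [Field F] (X : Set (ValuationSubring F)) : Set F :=
  ⋂ V ∈ X, ((↑) : V → F) '' (IsLocalRing.maximalIdeal V : Set V)

/-- A valuation ring has rank one if its Krull dimension is one. -/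
def IsRankOne {F : Type*} [Field F] (V : ValuationSubring F) : Prop :=
  ringKrullDim V = 1

/-- A Prüfer domain: a domain whose localizations at maximal ideals are valuation domains. -/
def IsPruferDomain (R : Type*) [CommRing R] : Prop :=
  IsDomain R ∧ ∀ (M : Ideal R) [M.IsMaximal],
    ∃ _ : IsDomain (Localization.AtPrime M), ValuationRing (Localization.AtPrime M)

/-- A G-domain: a domain in which the intersection of the nonzero prime ideals is nonzero
(for a field this empty intersection is the whole ring). -/
def IsGDomain (R : Type*) [CommRing R] : Prop :=
  IsDomain R ∧ sInf {P : Ideal R | P.IsPrime ∧ P ≠ ⊥} ≠ ⊥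

/-! Both properties become statements about elements of F that pass to overrings. A subring A is
Prüfer with quotient field F iff (A : t) + (A : t⁻¹) = A for every t, which `SplitsAt` records by a
witness a; it is moreover a G-domain iff F = A[1/g] for some nonzero g ∈ A.

Since A(X) ⊆ A(lim X), this settles the forward direction, with g ∈ J(X) because the centre of each
V ∈ X on A(X) is a nonzero prime.

Conversely, compactness of the patch topology puts each element of A(lim X) in all but finitely many
V ∈ X, and rank one lets powers of an element of J(X) repair the exceptions. This gives d ∈ J(X)
with A(X)[1/d] = F. For given t, a witness b over A(lim X) works at all V ∈ X off a finite set S,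
and some b' works on S. They are glued to b + (b' - b)e, where e is d-adically close to 1 on S and
to 0 on X \ S; a power of d absorbs the denominators of b' - b. -/

open Filter Topology

/-! ### Compactness of the patch topology and limit points -/

section Zar

variable {F : Type*} [Field F]

theorem mem_ringA {X : Set (ValuationSubring F)} {x : F} : x ∈ ringA X ↔ ∀ V ∈ X, x ∈ V := by
  simp [ringA, Subring.mem_iInf]

/-- The limit of an ultrafilter of valuation rings in the patch topology. -/
def ultrafilterLimit (f : Ultrafilter (ValuationSubring F)) : ValuationSubring F where
  carrier := {x | ∀ᶠ V in (f : Filter (ValuationSubring F)), x ∈ V}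
  mul_mem' ha hb := by filter_upwards [ha, hb] with V h1 h2 using mul_mem h1 h2
  one_mem' := Eventually.of_forall fun V => one_mem V
  add_mem' ha hb := by filter_upwards [ha, hb] with V h1 h2 using add_mem h1 h2
  zero_mem' := Eventually.of_forall fun V => zero_mem V
  neg_mem' ha := by filter_upwards [ha] with V h1 using neg_mem h1
  mem_or_inv_mem' x := Ultrafilter.eventually_or.1
    (Eventually.of_forall fun V => V.mem_or_inv_mem x)

theorem mem_ultrafilterLimit {f : Ultrafilter (ValuationSubring F)} {x : F} :
    x ∈ ultrafilterLimit f ↔ ∀ᶠ V in (f : Filter (ValuationSubring F)), x ∈ V := Iff.rfl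

theorem compactSpace_patchTopology :
    @CompactSpace (ValuationSubring F) (patchTopology F) := by
  let := patchTopology F
  refine ⟨isCompact_iff_ultrafilter_le_nhds.2 fun f _ => ⟨ultrafilterLimit f, trivial, ?_⟩⟩
  -- Convergence need only be tested on subbasic sets, where it is the definition of the limit ring.
  rw [TopologicalSpace.nhds_generateFrom]
  refine le_iInf₂ fun s hs => ?_
  obtain ⟨hs, ⟨x, rfl⟩ | ⟨x, rfl⟩⟩ := hs
  · exact le_principal_iff.2 hs
  · exact le_principal_iff.2 (Ultrafilter.eventually_not.2 hs)

/-- All but finitely many members of `X` contain a given element of `A(lim X)`. -/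
theorem finite_notMem_of_mem_ringA_patchLim {X : Set (ValuationSubring F)} {x : F}
    (hx : x ∈ ringA (patchLim X)) : {V ∈ X | x ∉ V}.Finite := by
  let := patchTopology F
  have : CompactSpace (ValuationSubring F) := compactSpace_patchTopology
  by_contra hinf
  obtain ⟨W, hW⟩ := Set.Infinite.exists_accPt_principal hinf
  have hWX : W ∈ patchLim X := hW.mono (principal_mono.2 fun V hV => hV.1)
  have hxW : x ∈ W := mem_ringA.1 hx W hWX
  have hopen : IsOpen {V : ValuationSubring F | x ∈ V} :=
    TopologicalSpace.isOpen_generateFrom_of_mem (Or.inl ⟨x, rfl⟩)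
  obtain ⟨V, ⟨hV1, hV2⟩, -⟩ := accPt_iff_nhds.1 hW _ (hopen.mem_nhds hxW)
  exact hV2.2 hV1

theorem ringA_le_ringA_patchLim (X : Set (ValuationSubring F)) :
    ringA X ≤ ringA (patchLim X) := by
  let := patchTopology F
  intro x hx
  rw [mem_ringA] at hx ⊢
  intro W hW
  by_contra hxW
  have hopen : IsOpen {V : ValuationSubring F | x ∉ V} :=
    TopologicalSpace.isOpen_generateFrom_of_mem (Or.inr ⟨x, rfl⟩)
  have hW' : AccPt W (𝓟 X) := hW
  obtain ⟨V, ⟨hV1, hV2⟩, -⟩ := accPt_iff_nhds.1 hW' _ (hopen.mem_nhds hxW)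
  exact hV1 (hx V hV2)

end Zar

/-! ### G-domains as rings R with R[1/g] equal to the quotient field -/

section GDomain

/-- For a denominator q of f, every prime containing q is nonzero, so g lies in the radical of (q)
and some power of g is a multiple of q. -/
theorem exists_pow_mul_mem_range {R F : Type*} [CommRing R] [IsDomain R] [Field F] [Algebra R F]
    [IsFractionRing R F] {g : R} (hg : ∀ P : Ideal R, P.IsPrime → P ≠ ⊥ → g ∈ P) (f : F) :
    ∃ n : ℕ, ∃ r : R, algebraMap R F r = algebraMap R F g ^ n * f := by
  obtain ⟨p, q, hq, rfl⟩ := IsFractionRing.div_surjective (A := R) f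
  have hq0 : q ≠ 0 := nonZeroDivisors.ne_zero hq
  have hrad : g ∈ (Ideal.span {q}).radical := by
    rw [Ideal.radical_eq_sInf, Submodule.mem_sInf]
    rintro P ⟨hqP, hP⟩
    refine hg P hP ?_
    rintro rfl
    exact hq0 (by simpa using hqP)
  obtain ⟨n, hn⟩ := hrad
  obtain ⟨c, hc⟩ := Ideal.mem_span_singleton.1 hn
  have hqF : algebraMap R F q ≠ 0 := by simpa using hq0
  refine ⟨n, c * p, ?_⟩
  rw [← map_pow, hc, map_mul, map_mul]
  field_simp

theorem isGDomain_of_exists_pow_mul_mem {F : Type*} [Field F] {A : Subring F} {g : F}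
    (hgA : g ∈ A) (hg0 : g ≠ 0) (hg : ∀ f : F, ∃ n : ℕ, g ^ n * f ∈ A) : IsGDomain A := by
  refine ⟨inferInstance, fun h => hg0 ?_⟩
  have : (⟨g, hgA⟩ : A) ∈ sInf {P : Ideal A | P.IsPrime ∧ P ≠ ⊥} := by
    rw [Submodule.mem_sInf]
    rintro P ⟨hP, hP0⟩
    obtain ⟨p, hpP, hp0⟩ := Submodule.exists_mem_ne_zero_of_ne_bot hP0
    obtain ⟨n, hn⟩ := hg (p : F)⁻¹
    refine hP.mem_of_pow_mem n ?_
    have : (⟨g, hgA⟩ : A) ^ n = ⟨_, hn⟩ * p := by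
      have : (p : F) ≠ 0 := by simpa using hp0
      ext
      simp [this]
    rw [this]
    exact Ideal.mul_mem_left P _ hpP
  rw [h] at this
  simpa using congrArg Subtype.val ((Submodule.mem_bot A).1 this)

theorem IsGDomain.exists_mem_prime {R : Type*} [CommRing R] (h : IsGDomain R) :
    ∃ g : R, g ≠ 0 ∧ ∀ P : Ideal R, P.IsPrime → P ≠ ⊥ → g ∈ P := by
  obtain ⟨g, hg, hg0⟩ := Submodule.exists_mem_ne_zero_of_ne_bot h.2
  exact ⟨g, hg0, fun P hP hP0 => (Submodule.mem_sInf.1 hg) P ⟨hP, hP0⟩⟩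

end GDomain

/-! ### Prüfer domains through colon ideals -/

section Prufer

variable {F : Type*} [Field F]

/-- `a` splits the unit ideal of `A` along `t`: `a ∈ (A : t)` and `1 - a ∈ (A : t⁻¹)`. -/
def SplitsAt (A : Subring F) (t a : F) : Prop :=
  a ∈ A ∧ a * t ∈ A ∧ (1 - a) * t⁻¹ ∈ A

theorem SplitsAt.mono {A B : Subring F} (h : A ≤ B) {t a : F} (ha : SplitsAt A t a) :
    SplitsAt B t a := ⟨h ha.1, h ha.2.1, h ha.2.2⟩

theorem isFractionRing_of_splitsAt {A : Subring F} (h : ∀ t, ∃ a, SplitsAt A t a) :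
    IsFractionRing A F := by
  refine IsFractionRing.of_field A F fun t => ?_
  obtain ⟨a, ha, hat, hbt⟩ := h t
  by_cases ha0 : a = 0
  · subst ha0
    refine ⟨1, ⟨_, hbt⟩, ?_⟩
    change t = (1 : F) / ((1 - 0) * t⁻¹)
    simp
  · refine ⟨⟨_, hat⟩, ⟨a, ha⟩, ?_⟩
    change t = a * t / a
    field_simp

/-- For t = q/p, either a or 1 - a lies outside M and becomes a unit in the localization;
accordingly p divides q or q divides p there. -/
theorem isPruferDomain_of_splitsAt {A : Subring F} (h : ∀ t, ∃ a, SplitsAt A t a) :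
    IsPruferDomain A := by
  refine ⟨inferInstance, fun M _ => ?_⟩
  have hdom : IsDomain (Localization.AtPrime M) :=
    IsLocalization.isDomain_localization (Ideal.primeCompl_le_nonZeroDivisors M)
  refine ⟨hdom, { cond' := fun x y => ?_ }⟩
  obtain ⟨⟨p, s⟩, hx⟩ := IsLocalization.surj M.primeCompl x
  obtain ⟨⟨q, u⟩, hy⟩ := IsLocalization.surj M.primeCompl y
  have hs := IsLocalization.map_units (Localization.AtPrime M) s
  have hu := IsLocalization.map_units (Localization.AtPrime M) u
  have key : ∀ (p q : A) (c r : A), c ∉ M → c * q = r * p →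
      algebraMap A (Localization.AtPrime M) p ∣ algebraMap A (Localization.AtPrime M) q := by
    intro p q c r hc hcr
    have hcu := IsLocalization.map_units (Localization.AtPrime M) (⟨c, hc⟩ : M.primeCompl)
    rw [← hcu.dvd_mul_left, ← map_mul, hcr, map_mul]
    exact Dvd.intro_left _ rfl
  have hdiv : algebraMap A (Localization.AtPrime M) p ∣ algebraMap A (Localization.AtPrime M) q ∨
      algebraMap A (Localization.AtPrime M) q ∣ algebraMap A (Localization.AtPrime M) p := by
    by_cases hp0 : p = 0
    · right; simp [hp0]
    by_cases hq0 : q = 0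
    · left; simp [hq0]
    have hp0' : (p : F) ≠ 0 := by simpa using hp0
    have hq0' : (q : F) ≠ 0 := by simpa using hq0
    obtain ⟨a, ha, hat, hbt⟩ := h ((q : F) / p)
    by_cases haM : (⟨a, ha⟩ : A) ∈ M
    · right
      refine key q p (1 - ⟨a, ha⟩) ⟨_, hbt⟩ (fun hb => ?_) ?_
      · exact (Ideal.ne_top_iff_one M).1 (Ideal.IsMaximal.ne_top ‹_›)
          (by simpa using M.add_mem hb haM)
      · ext
        simp
        field_simp
    · left
      refine key p q ⟨a, ha⟩ ⟨_, hat⟩ haM ?_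
      ext
      simp
      field_simp
  have hxy : x ∣ y ∨ y ∣ x := by
    rw [← hx, ← hy] at hdiv
    exact hdiv.imp (fun h => hs.mul_right_dvd.1 (hu.dvd_mul_right.1 h))
      fun h => hu.mul_right_dvd.1 (hs.dvd_mul_right.1 h)
  rcases hxy with ⟨c, hc⟩ | ⟨c, hc⟩
  exacts [⟨c, Or.inl hc.symm⟩, ⟨c, Or.inr hc.symm⟩]

/-- If both colon ideals lay in a maximal ideal M, neither t nor t⁻¹ would have a denominator
outside M, although one of them lies in the valuation ring A_M. -/
theorem IsPruferDomain.exists_splitsAt {A : Subring F} (hA : IsPruferDomain A)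
    [IsFractionRing A F] (t : F) : ∃ a, SplitsAt A t a := by
  by_cases ht : t = 0
  · exact ⟨0, A.zero_mem, by simp [A.zero_mem], by simp [ht, A.zero_mem]⟩
  let colon (t : F) : Ideal A :=
    { carrier := {s | (s : F) * t ∈ A}
      add_mem' := fun ha hb => by
        simpa [add_mul] using A.add_mem ha hb
      zero_mem' := by simp [A.zero_mem]
      smul_mem' := fun c x hx => by
        simpa [mul_assoc] using A.mul_mem c.2 hx }
  have hcolon : ∀ t (s : A), s ∈ colon t ↔ (s : F) * t ∈ A := fun _ _ => Iff.rfl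
  have htop : colon t ⊔ colon t⁻¹ = ⊤ := by
    by_contra hne
    obtain ⟨M, hM, hle⟩ := Ideal.exists_le_maximal _ hne
    obtain ⟨_, hval⟩ := hA.2 M
    obtain ⟨p, q, hq, rfl⟩ := IsFractionRing.div_surjective (A := A) t
    have key : ∀ p q : A, p ≠ 0 →
        (∃ c, algebraMap A (Localization.AtPrime M) p * c =
          algebraMap A (Localization.AtPrime M) q) →
        ∃ s ∉ M, s ∈ colon ((q : F) / p) := by
      rintro p q hp ⟨c, hc⟩
      obtain ⟨⟨r, s⟩, hr⟩ := IsLocalization.surj M.primeCompl c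
      refine ⟨s, s.2, ?_⟩
      have h1 : algebraMap A (Localization.AtPrime M) (q * s) =
          algebraMap A (Localization.AtPrime M) (p * r) := by
        rw [map_mul, map_mul, ← hr, ← hc, mul_assoc]
      have h2 : q * s = p * r :=
        IsLocalization.injective _ (Ideal.primeCompl_le_nonZeroDivisors M) h1
      have h3 : (q : F) * (s : A) = p * r := by exact_mod_cast congrArg Subtype.val h2
      have hp' : (p : F) ≠ 0 := by simpa using hp
      rw [hcolon]
      have : ((s : A) : F) * (q / p) = r := by
        field_simp
        linear_combination h3
      rw [this]
      exact r.2
    have hq0 : q ≠ 0 := nonZeroDivisors.ne_zero hq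
    have hp0 : p ≠ 0 := by
      rintro rfl
      simp at ht
    obtain ⟨c, hc | hc⟩ := ValuationRing.cond (algebraMap A (Localization.AtPrime M) q)
      (algebraMap A (Localization.AtPrime M) p)
    · obtain ⟨s, hsM, hs⟩ := key q p hq0 ⟨c, hc⟩
      exact hsM (hle (Ideal.mem_sup_left hs))
    · obtain ⟨s, hsM, hs⟩ := key p q hp0 ⟨c, hc⟩
      refine hsM (hle (Ideal.mem_sup_right ?_))
      rw [inv_div]
      exact hs
  obtain ⟨a, ha, b, hb, hab⟩ := Submodule.mem_sup.1 ((Ideal.eq_top_iff_one _).1 htop)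
  refine ⟨a, a.2, ha, ?_⟩
  have : (1 : F) - a = b := by
    have := congrArg (Subtype.val) hab
    push_cast at this
    linear_combination -this
  rw [this]
  exact hb

end Prufer

/-! ### Rank one valuation rings -/

section RankOne

variable {F : Type*} [Field F]

theorem mem_radJ {X : Set (ValuationSubring F)} {x : F} :
    x ∈ radJ X ↔ ∀ V ∈ X, V.valuation x < 1 := by
  simp only [radJ, Set.mem_iInter, Set.mem_image, SetLike.mem_coe]
  refine forall₂_congr fun V _ => ⟨?_, fun h => ?_⟩
  · rintro ⟨y, hy, rfl⟩
    exact (V.valuation_lt_one_iff y).1 hy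
  · exact ⟨⟨x, (V.valuation_le_one_iff x).1 h.le⟩, (V.valuation_lt_one_iff _).2 h, rfl⟩

theorem exists_ne_zero_mem_radJ {X : Set (ValuationSubring F)} (h : radJ X ≠ {0}) :
    ∃ d ≠ 0, ∀ V ∈ X, V.valuation d < 1 := by
  by_contra! hd
  refine h (Set.eq_singleton_iff_unique_mem.2 ⟨mem_radJ.2 fun V _ => by simp, fun x hx => ?_⟩)
  by_contra hx0
  obtain ⟨V, hV, hle⟩ := hd x hx0
  exact absurd (mem_radJ.1 hx V hV) hle.not_gt

theorem IsRankOne.ne_top {V : ValuationSubring F} (h : IsRankOne V) : V ≠ ⊤ := by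
  rintro rfl
  have := ringKrullDim_eq_zero_of_field (⊤ : ValuationSubring F)
  rw [IsRankOne, this] at h
  exact zero_ne_one h

/-- In dimension one the maximal ideal is the only nonzero prime, so d lies in every nonzero prime.
-/
theorem IsRankOne.exists_pow_mul_mem {V : ValuationSubring F} (h : IsRankOne V) {d : F}
    (hd : V.valuation d < 1) (f : F) : ∃ n : ℕ, d ^ n * f ∈ V := by
  have hdim : Ring.KrullDimLE 1 V := (Order.krullDimLE_iff _ _).2 h.le
  have hdV : d ∈ V := (V.valuation_le_one_iff d).1 hd.le
  obtain ⟨n, r, hr⟩ := exists_pow_mul_mem_range (g := (⟨d, hdV⟩ : V)) (fun P hP hP0 => by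
    rw [IsLocalRing.eq_maximalIdeal (hP.isMaximal_of_ne_bot hP0)]
    exact (V.valuation_lt_one_iff _).2 hd) f
  refine ⟨n, ?_⟩
  have : d ^ n * f = r := hr.symm
  rw [this]
  exact r.2

theorem pow_mul_mem_of_le {V : Subring F} {d f : F} (hd : d ∈ V) {m n : ℕ} (hmn : m ≤ n)
    (h : d ^ m * f ∈ V) : d ^ n * f ∈ V := by
  obtain ⟨k, rfl⟩ := Nat.exists_eq_add_of_le hmn
  have : d ^ (m + k) * f = d ^ k * (d ^ m * f) := by ring
  rw [this]
  exact V.mul_mem (V.pow_mem hd k) h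

/-- A statement that holds for all large exponents at each of finitely many rank one valuation
rings holds for one exponent at all of them. -/
theorem exists_forall_ge_of_finite {ι : Type*} {s : Set ι} (hs : s.Finite) {p : ι → ℕ → Prop}
    (h : ∀ i ∈ s, ∃ n, ∀ m ≥ n, p i m) : ∃ n, ∀ m ≥ n, ∀ i ∈ s, p i m := by
  have : ∀ᶠ m in atTop, ∀ i ∈ s, p i m :=
    (eventually_all_finite hs).2 fun i hi => eventually_atTop.2 (h i hi)
  exact eventually_atTop.1 this

end RankOne

/-! ### Approximation by elements z / (1 + z) -/

section Cutoff

variable {F : Type*} [Field F]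

theorem valuation_div_one_add_le {V : ValuationSubring F} {z c : F} (hc : V.valuation c < 1)
    (hz : V.valuation z ≤ V.valuation c) : V.valuation (z / (1 + z)) ≤ V.valuation c := by
  rw [map_div₀, V.valuation.map_one_add_of_lt (hz.trans_lt hc), div_one]
  exact hz

theorem valuation_one_sub_div_one_add_le {V : ValuationSubring F} {z c : F}
    (hc : V.valuation c < 1) (hz : 1 ≤ V.valuation (c * z)) :
    V.valuation (1 - z / (1 + z)) ≤ V.valuation c := by
  rw [map_mul] at hz
  have hz0 : V.valuation z ≠ 0 := by
    intro h
    rw [h, mul_zero] at hz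
    exact absurd hz zero_lt_one.not_ge
  have hz1 : 1 < V.valuation z := by
    by_contra! h
    exact absurd (mul_lt_one_of_lt_of_le hc h) hz.not_gt
  have hv : V.valuation (1 + z) = V.valuation z :=
    V.valuation.map_add_eq_of_lt_right (by rwa [map_one])
  have hne : 1 + z ≠ 0 := by
    intro h
    rw [h, map_zero] at hv
    exact hz0 hv.symm
  have : 1 - z / (1 + z) = (1 + z)⁻¹ := by
    field_simp
    ring
  rw [this, map_inv₀, hv]
  exact (inv_le_iff_one_le_mul₀ (zero_lt_iff.2 hz0)).2 hz

/-- Elements along which the unit ideal splits exist for finitely many rank one valuation rings. -/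
theorem exists_splitsAt_of_finite {E : Set (ValuationSubring F)} (hE : E.Finite)
    (hrank : ∀ V ∈ E, IsRankOne V) {d : F} (hd0 : d ≠ 0) (hd : ∀ V ∈ E, V.valuation d < 1)
    (t : F) : ∃ b, ∀ V ∈ E, SplitsAt V.toSubring t b := by
  by_cases ht : t = 0
  · exact ⟨0, fun V _ => ⟨V.zero_mem, by simp, by simp [ht]⟩⟩
  have hexp : ∀ V ∈ E, ∃ n, ∀ m ≥ n, V.valuation t < 1 → t ^ m * (d * t)⁻¹ ∈ V := by
    intro V hV
    by_cases htV : V.valuation t < 1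
    · obtain ⟨n, hn⟩ := (hrank V hV).exists_pow_mul_mem htV (d * t)⁻¹
      exact ⟨n, fun m hm _ =>
        pow_mul_mem_of_le (V := V.toSubring) ((V.valuation_le_one_iff t).1 htV.le) hm hn⟩
    · exact ⟨0, fun m _ h => absurd h htV⟩
  obtain ⟨n, hn⟩ := exists_forall_ge_of_finite hE hexp
  -- The witness is 1 / (1 + z). If v(t) < 1, large n makes z a multiple of t. If v(t) ≥ 1, the
  -- divisor d forces v(z) > 1, even when v(t) = 1, and v(1 / (1 + z)) ≤ v(d t⁻¹).
  set z := t ^ (n + 1) / d with hz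
  have hsplit : 1 - (1 - z / (1 + z)) = z / (1 + z) := by ring
  refine ⟨1 - z / (1 + z), fun V hV => ?_⟩
  simp only [SplitsAt, ValuationSubring.mem_toSubring, hsplit]
  by_cases htV : V.valuation t < 1
  · have htmem : t ∈ V := (V.valuation_le_one_iff t).1 htV.le
    have h1 := hn (n + 1) (Nat.le_succ n) V hV htV
    have h2 : V.valuation z ≤ V.valuation t := by
      have : z = t * (t ^ (n + 1) * (d * t)⁻¹) := by
        rw [hz]
        field_simp
      rw [this, map_mul]
      exact mul_le_of_le_one_right' ((V.valuation_le_one_iff _).2 h1)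
    have h3 := valuation_div_one_add_le htV h2
    have h4 : 1 - z / (1 + z) ∈ V :=
      sub_mem V.one_mem ((V.valuation_le_one_iff _).1 (h3.trans htV.le))
    refine ⟨h4, V.mul_mem _ _ h4 htmem, (V.valuation_le_one_iff _).1 ?_⟩
    rw [map_mul, map_inv₀]
    exact mul_inv_le_one_of_le₀ h3 zero_le
  · rw [not_lt] at htV
    have hinv : V.valuation t⁻¹ ≤ 1 := by
      rw [map_inv₀]
      exact inv_le_one_of_one_le₀ htV
    have htmem : t⁻¹ ∈ V := (V.valuation_le_one_iff _).1 hinv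
    have hc : V.valuation (d * t⁻¹) < 1 := by
      rw [map_mul]
      exact mul_lt_one_of_lt_of_le (hd V hV) hinv
    have h3 := valuation_one_sub_div_one_add_le (z := z) hc (by
      have : d * t⁻¹ * z = t ^ n := by
        rw [hz]
        field_simp
        ring
      rw [this, map_pow]
      exact one_le_pow₀ htV)
    have h4 : 1 - z / (1 + z) ∈ V := (V.valuation_le_one_iff _).1 (h3.trans hc.le)
    refine ⟨h4, (V.valuation_le_one_iff _).1 ?_, V.mul_mem _ _ ?_ htmem⟩
    · rw [map_mul]
      calc V.valuation (1 - z / (1 + z)) * V.valuation t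
          ≤ V.valuation (d * t⁻¹) * V.valuation t := by gcongr
        _ = V.valuation d := by rw [← map_mul, inv_mul_cancel_right₀ ht]
        _ ≤ 1 := (hd V hV).le
    · rw [← hsplit]
      exact sub_mem V.one_mem h4

/-- `e` is congruent to `1` modulo `c` on `S ∩ X` and to `0` modulo `c` on `X \ S`. -/
def IsCutoff (X S : Set (ValuationSubring F)) (c e : F) : Prop :=
  ∀ V ∈ X, (V ∈ S → V.valuation (1 - e) ≤ V.valuation c) ∧
    (V ∉ S → V.valuation e ≤ V.valuation c)

theorem IsCutoff.union {X S T : Set (ValuationSubring F)} {c e f : F}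
    (hc : ∀ V ∈ X, V.valuation c ≤ 1) (he : IsCutoff X S c e) (hf : IsCutoff X T c f) :
    IsCutoff X (S ∪ T) c (1 - (1 - e) * (1 - f)) := by
  have bound : ∀ {S : Set (ValuationSubring F)} {e : F}, IsCutoff X S c e →
      ∀ V ∈ X, V.valuation (1 - e) ≤ 1 := by
    intro S e he V hV
    by_cases hS : V ∈ S
    · exact ((he V hV).1 hS).trans (hc V hV)
    · exact (V.valuation_le_one_iff _).2
        (sub_mem V.one_mem ((V.valuation_le_one_iff _).1 (((he V hV).2 hS).trans (hc V hV))))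
  refine fun V hV => ⟨fun h => ?_, fun h => ?_⟩
  · rw [sub_sub_cancel, map_mul]
    rcases h with h | h
    · exact (mul_le_of_le_one_right' (bound hf V hV)).trans ((he V hV).1 h)
    · exact (mul_le_of_le_one_left' (bound he V hV)).trans ((hf V hV).1 h)
  · rw [Set.mem_union, not_or] at h
    have : 1 - (1 - e) * (1 - f) = e + f * (1 - e) := by ring
    rw [this]
    refine V.valuation.map_add_le ((he V hV).2 h.1) ?_
    rw [map_mul]
    exact (mul_le_of_le_one_right' (bound he V hV)).trans ((hf V hV).2 h.2)

theorem exists_isCutoff {X : Set (ValuationSubring F)} (hrank : ∀ V ∈ X, IsRankOne V) {c : F}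
    (hc0 : c ≠ 0) (hc : ∀ V ∈ X, V.valuation c < 1) {x : F} (hx : {V ∈ X | x ∉ V}.Finite) :
    ∃ e, IsCutoff X {V | x ∉ V} c e := by
  have hexp : ∀ V ∈ {V ∈ X | x ∉ V}, ∃ n, ∀ m ≥ n, x⁻¹ ^ m * (c ^ 2)⁻¹ ∈ V := by
    rintro V ⟨hV, hxV⟩
    have hlt : V.valuation x⁻¹ < 1 := by
      rw [map_inv₀]
      exact inv_lt_one_of_one_lt₀ (lt_of_not_ge fun h => hxV ((V.valuation_le_one_iff x).1 h))
    obtain ⟨n, hn⟩ := (hrank V hV).exists_pow_mul_mem hlt (c ^ 2)⁻¹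
    exact ⟨n, fun m hm =>
      pow_mul_mem_of_le (V := V.toSubring) ((V.valuation_le_one_iff _).1 hlt.le) hm hn⟩
  obtain ⟨n, hn⟩ := exists_forall_ge_of_finite hx hexp
  -- With z = c xⁿ, x ∈ V gives v(z) ≤ v(c). Otherwise n was chosen so that v(c² xⁿ) ≥ 1: one factor
  -- c belongs to z, the other to the required precision.
  refine ⟨c * x ^ n / (1 + c * x ^ n), fun V hV => ⟨fun h => ?_, fun h => ?_⟩⟩
  · refine valuation_one_sub_div_one_add_le (hc V hV) ?_
    have h1 := (V.valuation_le_one_iff _).2 (hn n le_rfl V ⟨hV, h⟩)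
    have hx0 : x ≠ 0 := by
      rintro rfl
      exact h V.zero_mem
    have h2 : x⁻¹ ^ n * (c ^ 2)⁻¹ = (c * (c * x ^ n))⁻¹ := by
      rw [inv_pow, ← mul_inv]
      ring
    rw [h2, map_inv₀] at h1
    refine (inv_le_one₀ (zero_lt_iff.2 ?_)).1 h1
    simp [hc0, hx0]
  · refine valuation_div_one_add_le (hc V hV) ?_
    rw [map_mul]
    refine mul_le_of_le_one_right' ((V.valuation_le_one_iff _).2 (pow_mem ?_ n))
    exact not_not.1 h

end Cutoff

/-! ### Gluing witnesses and descending from A(lim X) to A(X) -/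

section Main

variable {F : Type*} [Field F]

theorem SplitsAt.of_sub_mem {A : Subring F} {t a b : F} (ha : SplitsAt A t a)
    (h1 : b - a ∈ A) (h2 : (b - a) * t ∈ A) (h3 : (b - a) * t⁻¹ ∈ A) : SplitsAt A t b := by
  refine ⟨?_, ?_, ?_⟩
  · simpa using A.add_mem ha.1 h1
  · simpa [sub_mul] using A.add_mem ha.2.1 h2
  · have := A.sub_mem ha.2.2 h3
    have h : (1 - a) * t⁻¹ - (b - a) * t⁻¹ = (1 - b) * t⁻¹ := by ring
    rwa [h] at this

theorem mul_mem_of_valuation_le {V : ValuationSubring F} {x c e : F} (hx : c * x ∈ V)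
    (he : V.valuation e ≤ V.valuation c) : x * e ∈ V := by
  rw [← V.valuation_le_one_iff, map_mul] at hx ⊢
  rw [mul_comm]
  exact (mul_le_mul_left he _).trans hx

theorem exists_splitsAt_ringA {X : Set (ValuationSubring F)} (hrank : ∀ V ∈ X, IsRankOne V)
    {d : F} (hd0 : d ≠ 0) (hd : ∀ V ∈ X, V.valuation d < 1)
    (hgen : ∀ f : F, ∃ n : ℕ, d ^ n * f ∈ ringA X)
    (hlim : ∀ t, ∃ b, SplitsAt (ringA (patchLim X)) t b) (t : F) :
    ∃ a, SplitsAt (ringA X) t a := by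
  obtain ⟨b, hb1, hb2, hb3⟩ := hlim t
  have f1 := finite_notMem_of_mem_ringA_patchLim hb1
  have f2 := finite_notMem_of_mem_ringA_patchLim hb2
  have f3 := finite_notMem_of_mem_ringA_patchLim hb3
  set S : Set (ValuationSubring F) :=
    ({V | b ∉ V} ∪ {V | b * t ∉ V}) ∪ {V | (1 - b) * t⁻¹ ∉ V} with hS
  have hfin : {V ∈ X | V ∈ S}.Finite := by
    refine ((f1.union f2).union f3).subset ?_
    rintro V ⟨hV, (h | h) | h⟩
    exacts [Or.inl (Or.inl ⟨hV, h⟩), Or.inl (Or.inr ⟨hV, h⟩), Or.inr ⟨hV, h⟩]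
  obtain ⟨b', hb'⟩ := exists_splitsAt_of_finite hfin (fun V hV => hrank V hV.1) hd0
    (fun V hV => hd V hV.1) t
  have hdA : d ∈ ringA X := mem_ringA.2 fun V hV => (V.valuation_le_one_iff d).1 (hd V hV).le
  obtain ⟨n, hn⟩ : ∃ n, ∀ m ≥ n, ∀ f ∈ ({b' - b, (b' - b) * t, (b' - b) * t⁻¹} : Set F),
      d ^ m * f ∈ ringA X := by
    refine exists_forall_ge_of_finite (Set.toFinite _) fun f _ => ?_
    obtain ⟨n, hn⟩ := hgen f
    exact ⟨n, fun m hm => pow_mul_mem_of_le hdA hm hn⟩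
  -- The exponent n + 1 is positive, so this power of d still has value below 1 on X, as the cutoffs
  -- require.
  have hn' := hn (n + 1) n.le_succ
  have hc : ∀ V ∈ X, V.valuation (d ^ (n + 1)) < 1 := fun V hV => by
    rw [map_pow]
    exact pow_lt_one' (hd V hV) n.succ_ne_zero
  have hc0 := pow_ne_zero (n + 1) hd0
  obtain ⟨e1, he1⟩ := exists_isCutoff hrank hc0 hc f1
  obtain ⟨e2, he2⟩ := exists_isCutoff hrank hc0 hc f2
  obtain ⟨e3, he3⟩ := exists_isCutoff hrank hc0 hc f3
  have hc1 : ∀ V ∈ X, V.valuation (d ^ (n + 1)) ≤ 1 := fun V hV => (hc V hV).le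
  have he := (he1.union hc1 he2).union hc1 he3
  rw [← hS] at he
  set e := 1 - (1 - (1 - (1 - e1) * (1 - e2))) * (1 - e3)
  have hmul : ∀ V ∈ X, ∀ f, V.valuation f ≤ V.valuation (d ^ (n + 1)) →
      (b' - b) * f ∈ V ∧ (b' - b) * f * t ∈ V ∧ (b' - b) * f * t⁻¹ ∈ V := by
    intro V hV f hf
    rw [mul_right_comm _ f t, mul_right_comm _ f t⁻¹]
    refine ⟨?_, ?_, ?_⟩ <;>
      exact mul_mem_of_valuation_le (mem_ringA.1 (hn' _ (by simp)) V hV) hf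
  have hV : ∀ V ∈ X, SplitsAt V.toSubring t (b + (b' - b) * e) := by
    intro V hVX
    by_cases hVS : V ∈ S
    · obtain ⟨h1, h2, h3⟩ := hmul V hVX (1 - e) ((he V hVX).1 hVS)
      have heq : b + (b' - b) * e - b' = -((b' - b) * (1 - e)) := by ring
      refine (hb' V ⟨hVX, hVS⟩).of_sub_mem ?_ ?_ ?_ <;> rw [heq]
      · exact neg_mem h1
      · rw [neg_mul]
        exact neg_mem h2
      · rw [neg_mul]
        exact neg_mem h3
    · obtain ⟨h1, h2, h3⟩ := hmul V hVX e ((he V hVX).2 hVS)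
      have heq : b + (b' - b) * e - b = (b' - b) * e := by ring
      simp only [hS, Set.mem_union, Set.mem_ofPred_eq, not_or, not_not] at hVS
      have hbV : SplitsAt V.toSubring t b := ⟨hVS.1.1, hVS.1.2, hVS.2⟩
      refine hbV.of_sub_mem ?_ ?_ ?_ <;> rw [heq]
      exacts [h1, h2, h3]
  exact ⟨_, mem_ringA.2 fun V h => (hV V h).1, mem_ringA.2 fun V h => (hV V h).2.1,
    mem_ringA.2 fun V h => (hV V h).2.2⟩

/-- If `A(lim X)` is a `G`-domain with quotient field `F`, then some nonzero `d ∈ J(X)` satisfies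
`A(X)[1/d] = F`. -/
theorem exists_pow_mul_mem_ringA {X : Set (ValuationSubring F)}
    (hrank : ∀ V ∈ X, IsRankOne V) (hJ : radJ X ≠ {0}) (hG : IsGDomain (ringA (patchLim X)))
    [IsFractionRing (ringA (patchLim X)) F] :
    ∃ d ≠ 0, (∀ V ∈ X, V.valuation d < 1) ∧ ∀ f : F, ∃ n : ℕ, d ^ n * f ∈ ringA X := by
  obtain ⟨c, hc0, hc⟩ := exists_ne_zero_mem_radJ hJ
  obtain ⟨g, hg0, hg⟩ := hG.exists_mem_prime
  have hg0' : (g : F) ≠ 0 := by simpa using hg0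
  have hgfin := finite_notMem_of_mem_ringA_patchLim g.2
  obtain ⟨k, hk⟩ := exists_forall_ge_of_finite hgfin
    (p := fun V m => c ^ m * (g : F) ∈ V) (fun V hV => by
      obtain ⟨n, hn⟩ := (hrank V hV.1).exists_pow_mul_mem (hc V hV.1) (g : F)
      exact ⟨n, fun m hm => pow_mul_mem_of_le (V := V.toSubring)
        ((V.valuation_le_one_iff _).1 (hc V hV.1).le) hm hn⟩)
  have hmem : ∀ V ∈ X, c ^ k * (g : F) ∈ V := by
    intro V hV
    by_cases hgV : (g : F) ∈ V
    · exact V.mul_mem _ _ (pow_mem ((V.valuation_le_one_iff _).1 (hc V hV).le) k) hgV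
    · exact hk k le_rfl V ⟨hV, hgV⟩
  -- The factor c ^ k brings g into every V ∈ X; the extra c brings the product into every maximal
  -- ideal.
  set d := c * (c ^ k * g) with hd
  have hd0 : d ≠ 0 := by simp [hd, hc0, hg0']
  have hdX : ∀ V ∈ X, V.valuation d < 1 := fun V hV => by
    rw [hd, map_mul]
    exact mul_lt_one_of_lt_of_le (hc V hV) ((V.valuation_le_one_iff _).2 (hmem V hV))
  have hcB : c ∈ ringA (patchLim X) := ringA_le_ringA_patchLim X
    (mem_ringA.2 fun V hV => (V.valuation_le_one_iff _).1 (hc V hV).le)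
  refine ⟨d, hd0, hdX, fun f => ?_⟩
  have hdmem : ∀ V ∈ X, d ∈ V := fun V hV => (V.valuation_le_one_iff _).1 (hdX V hV).le
  obtain ⟨m, r, hr⟩ := exists_pow_mul_mem_range (F := F) hg f
  have hB : d ^ m * f ∈ ringA (patchLim X) := by
    have h : d ^ m * f = (c ^ (k + 1)) ^ m * r := by
      change (r : F) = (g : F) ^ m * f at hr
      rw [hr, hd]
      ring
    rw [h]
    exact Subring.mul_mem _ (pow_mem (pow_mem hcB _) _) r.2
  have hfin := finite_notMem_of_mem_ringA_patchLim hB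
  obtain ⟨n, hn⟩ := exists_forall_ge_of_finite hfin
    (p := fun V m => d ^ m * f ∈ V) (fun V hV => by
      obtain ⟨n, hn⟩ := (hrank V hV.1).exists_pow_mul_mem (hdX V hV.1) f
      exact ⟨n, fun m hm => pow_mul_mem_of_le (V := V.toSubring) (hdmem V hV.1) hm hn⟩)
  refine ⟨max m n, mem_ringA.2 fun V hV => ?_⟩
  by_cases h : d ^ m * f ∈ V
  · exact pow_mul_mem_of_le (V := V.toSubring) (hdmem V hV) (le_max_left _ _) h
  · exact hn _ (le_max_right _ _) V ⟨hV, h⟩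

/-- The centre of V on A is a nonzero prime: were it zero, all nonzero elements of A would be units
of V, forcing V = F. -/
theorem valuation_lt_one_of_mem_prime {A : Subring F} [IsFractionRing A F]
    {V : ValuationSubring F} (hAV : A ≤ V.toSubring) (hV : V ≠ ⊤) {g : A}
    (hg : ∀ P : Ideal A, P.IsPrime → P ≠ ⊥ → g ∈ P) : V.valuation (g : F) < 1 := by
  have hcomap : ∀ a : A, a ∈ (IsLocalRing.maximalIdeal V).comap (Subring.inclusion hAV) ↔
      V.valuation (a : F) < 1 := fun a =>
    V.valuation_lt_one_iff (Subring.inclusion hAV a)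
  rw [← hcomap]
  refine hg _ (Ideal.IsPrime.comap _) fun hbot => hV ?_
  rw [eq_top_iff]
  intro f _
  obtain ⟨p, q, hq, rfl⟩ := IsFractionRing.div_surjective (A := A) f
  have hq1 : ¬ V.valuation (q : F) < 1 := by
    rw [← hcomap, hbot]
    exact nonZeroDivisors.ne_zero hq
  rw [← V.valuation_le_one_iff, map_div₀]
  exact div_le_one_of_le₀ (((V.valuation_le_one_iff _).2 (hAV p.2)).trans (not_lt.1 hq1)) zero_le

end Main

theorem corollary4p4 {F : Type*} [Field F] (X : Set (ValuationSubring F)) (hX : X.Nonempty)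
    (hrank : ∀ V ∈ X, IsRankOne V) :
    (IsPruferDomain (ringA X) ∧ IsGDomain (ringA X) ∧ IsFractionRing (ringA X) F) ↔
      (radJ X ≠ {0} ∧ IsPruferDomain (ringA (patchLim X)) ∧ IsGDomain (ringA (patchLim X)) ∧
        IsFractionRing (ringA (patchLim X)) F) := by
  constructor
  · rintro ⟨hP, hG, hF⟩
    have hle := ringA_le_ringA_patchLim X
    have hsplit : ∀ t, ∃ a, SplitsAt (ringA (patchLim X)) t a := fun t =>
      (hP.exists_splitsAt t).imp fun a ha => ha.mono hle
    obtain ⟨g, hg0, hg⟩ := hG.exists_mem_prime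
    have hg0' : (g : F) ≠ 0 := by simpa using hg0
    refine ⟨fun hJ => hg0' ?_, isPruferDomain_of_splitsAt hsplit,
      isGDomain_of_exists_pow_mul_mem (hle g.2) hg0' fun f => ?_,
      isFractionRing_of_splitsAt hsplit⟩
    · have : (g : F) ∈ radJ X := mem_radJ.2 fun V hV =>
        valuation_lt_one_of_mem_prime (fun x hx => mem_ringA.1 hx V hV) (hrank V hV).ne_top hg
      rwa [hJ] at this
    · obtain ⟨n, r, hr⟩ := exists_pow_mul_mem_range (F := F) hg f
      change (r : F) = (g : F) ^ n * f at hr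
      exact ⟨n, hr ▸ hle r.2⟩
  · rintro ⟨hJ, hP, hG, hF⟩
    obtain ⟨d, hd0, hd, hgen⟩ := exists_pow_mul_mem_ringA hrank hJ hG
    have hsplit := exists_splitsAt_ringA hrank hd0 hd hgen hP.exists_splitsAt
    exact ⟨isPruferDomain_of_splitsAt hsplit,
      isGDomain_of_exists_pow_mul_mem
        (mem_ringA.2 fun V hV => (V.valuation_le_one_iff d).1 (hd V hV).le) hd0 hgen,
      isFractionRing_of_splitsAt hsplit⟩
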